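/- \textbf{Setting.} Let $\mathsf X,\mathsf A$ be finite sets and let $\mathcal H_{\mathsf X},\mathcal H_{\mathsf A}$ be the finite-dimensional complex Hilbert spaces with orthonormal bases $\{|x\rangle\}_{x\in\mathsf X}$ and $\{|a\rangle\}_{a\in\mathsf A}$. Let $\mathcal D(\mathcal H)$ denote the density operators and $\mathcal L_H(\mathcal H)$ the Hermitian operators on $\mathcal H$, and write $\langle A,B\rangle=\mathrm{Tr}(AB)$. A quantum channel is a completely positive trace-preserving linear map. A quantum Markov decision process is given by a quantum channel $\mathcal N$ from $\mathcal H_{\mathsf X}\otimes\mathcal H_{\mathsf A}$ to $\mathcal H_{\mathsf X}$, an operator $c\in\mathcal L_H(\mathcal H_{\mathsf X}\otimes\mathcal H_{\mathsf A})$ and a discount factor $\beta\in[0,1)$. Fix an initial state $\rho_0\in\mathcal D(\mathcal H_{\mathsf X})$. Let $\mathrm C_w$ be the set of quantum channels $\gamma$ from $\mathcal H_{\mathsf X}$ to $\mathcal H_{\mathsf X}\otimes\mathcal H_{\mathsf A}$ with $\mathrm{Tr}_{\mathsf A}(\gamma(|x\rangle\langle x|))=|x\rangle\langle x|$ for all $x\in\mathsf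 X$. A classical-state-preserving closed-loop policy is a sequence $\boldsymbol\gamma=(\gamma_t)_{t\ge 0}$ in $\mathrm C_w$; the set of these is $\Gamma_w$, and $\boldsymbol\gamma$ is stationary if $\gamma_t=\gamma$ for all $t$. Its cost is $$V(\boldsymbol\gamma,\rho_0)=\sum_{t\ge 0}\beta^t\langle c,\sigma_t\rangle,\qquad \sigma_t=\gamma_t(\rho_t),\quad \rho_{t+1}=\mathcal N(\sigma_t),$$ and $\boldsymbol\gamma\in\Gamma_w$ is optimal for $\rho_0$ if $V(\boldsymbol\gamma,\rho_0)=\min_{\boldsymbol\gamma'\in\Gamma_w}V(\boldsymbol\gamma',\rho_0)$. Put $\mathcal N_{qc}(\rho)=\sum_{x}\mathrm{Tr}(\rho|x\rangle\langle x|)\,|x\rangle\langle x|$ and $\mathrm T_w(\sigma)=\mathcal N_{qc}(\mathrm{Tr}_{\mathsf A}(\sigma))-\beta\,\mathcal N_{qc}(\mathcal N(\sigma))$. For an operator $\mathfrak C$ on $\mathcal H_{\mathsf X}\otimes(\mathcal H_{\mathsf X}\otimes\mathcal H_{\mathsf A})$ and an operator $\rho$ on $\mathcal H_{\mathsf X}$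 put $$\Lambda(\mathfrak C,\rho)=\langle\psi|(\rho\otimes\mathfrak C)|\psi\rangle,\qquad |\psi\rangle=\sum_x|x\rangle\otimes|x\rangle,$$ where $\psi$ is contracted with the first two tensor factors $\mathcal H_{\mathsf X}\otimes\mathcal H_{\mathsf X}$; the result is an operator on $\mathcal H_{\mathsf X}\otimes\mathcal H_{\mathsf A}$. The bilinear program (BIL-w) is to minimise $\langle c,\sigma\rangle$ over $\sigma\in\mathcal L_H(\mathcal H_{\mathsf X}\otimes\mathcal H_{\mathsf A})$ and $\mathfrak C\in\mathcal L_H(\mathcal H_{\mathsf X}\otimes\mathcal H_{\mathsf X}\otimes\mathcal H_{\mathsf A})$ subject to $$\mathrm T_w(\sigma)=(1-\beta)\,\mathcal N_{qc}(\rho_0),\quad \sigma\succcurlyeq 0,\qquad \mathrm{Tr}_{\mathsf X\times\mathsf A}(\mathfrak C)=\mathrm{Id}_{\mathsf X},\quad \mathfrak C\succcurlyeq 0,$$ $$\mathrm{Tr}_{\mathsf A}\big(\Lambda(\mathfrak C,|x\rangle\langle x|)\big)=|x\rangle\langle x|\ \ (x\in\mathsf X),\qquad \Lambda\big(\mathfrak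 C,(1-\beta)\rho_0+\beta\,\mathcal N(\sigma)\big)=\sigma,$$ where $\mathrm{Tr}_{\mathsf X\times\mathsf A}$ traces out the last two tensor factors. \textbf{Assumption (A).} There is $\xi^*\in\mathcal L_H(\mathcal H_{\mathsf X})$ with $c+\beta\,\mathcal N^\dagger(\mathcal N_{qc}(\xi^*))\succcurlyeq\mathcal N_{qc}(\xi^*)\otimes\mathrm{Id}$ such that, for every $\rho\in\mathcal D(\mathcal H_{\mathsf X})$, $$\min_{\gamma\in\mathrm C_w}\big\langle c+\beta\,\mathcal N^\dagger(\mathcal N_{qc}(\xi^*)),\gamma(\rho)\big\rangle=\langle\mathcal N_{qc}(\xi^*),\rho\rangle,$$ where $\mathcal N^\dagger$ is the Hilbert--Schmidt adjoint of $\mathcal N$. \textbf{Proposition.} Let $(\sigma^*,\mathfrak C^*)$ be an optimal solution of (BIL-w) and let $\gamma^*(\rho)=\Lambda(\mathfrak C^*,\rho)$. Then $\gamma^*\in\mathrm C_w$, and the stationary policy $\{\gamma^*\}$ has the smallest cost $V(\cdot,\rho_0)$ among all stationary classical-state-preserving closed-loop policies. If Assumption (A) holds, then $\{\gamma^*\}$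 is optimal for $\rho_0$ among all classical-state-preserving closed-loop policies, i.e. $V(\{\gamma^*\},\rho_0)=\min_{\boldsymbol\gamma\in\Gamma_w}V(\boldsymbol\gamma,\rho_0)$. -/

import Mathlib

open scoped ComplexOrder Kronecker

namespace QMDP

section Quantum

variable {m n : Type*} [Fintype m] [DecidableEq m] [Fintype n] [DecidableEq n]

/-- Super-operators: linear maps between spaces of operators (matrices in fixed orthonormal
bases indexed by `m` and `n`). -/
abbrev SuperOp (m n : Type*) := Matrix m m ℂ →ₗ[ℂ] Matrix n n ℂ

/-- Density operators: positive semi-definite with unit trace. -/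
def IsDensity (ρ : Matrix m m ℂ) : Prop := ρ.PosSemidef ∧ ρ.trace = 1

/-- The pure classical state `|x⟩⟨x|`. -/
def ketbra (x : m) : Matrix m m ℂ := Matrix.single x x 1

/-- The Hilbert-Schmidt inner product `Tr(A B)` of two Hermitian operators; it is a real
number, and we record it as such. -/
def hs (A B : Matrix m m ℂ) : ℝ := (A * B).trace.re

/-- The action of `Φ ⊗ Id` on operators of the composite of the input system with an
environment of dimension `k`. -/
def ampliate (Φ : SuperOp m n) (k : ℕ) (P : Matrix (m × Fin k) (m × Fin k) ℂ) :
    Matrix (n × Fin k) (n × Fin k) ℂ :=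
  Matrix.of fun p q => Φ (Matrix.of fun i j => P (i, p.2) (j, q.2)) p.1 q.1

/-- Quantum channels: completely positive and trace-preserving super-operators. -/
structure IsQuantumChannel (Φ : SuperOp m n) : Prop where
  completelyPositive : ∀ (k : ℕ) (P : Matrix (m × Fin k) (m × Fin k) ℂ),
    P.PosSemidef → (ampliate Φ k P).PosSemidef
  tracePreserving : ∀ ρ : Matrix m m ℂ, (Φ ρ).trace = ρ.trace

/-- Partial trace over the second factor. -/
def partialTrace : SuperOp (m × n) m where
  toFun P := Matrix.of fun i j => ∑ a, P (i, a) (j, a)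
  map_add' P Q := by
    ext i j
    simp [Finset.sum_add_distrib]
  map_smul' r P := by
    ext i j
    simp [Finset.mul_sum]

/-- The quantum-to-classical channel `ρ ↦ ∑ₓ Tr(ρ |x⟩⟨x|) |x⟩⟨x|`. -/
def qcChannel : SuperOp m m where
  toFun ρ := ∑ x, (ρ * ketbra x).trace • ketbra x
  map_add' ρ τ := by
    simp [add_mul, add_smul, Finset.sum_add_distrib]
  map_smul' r ρ := by
    simp [Finset.smul_sum, smul_smul]

/-- The adjoint of a super-operator for the Hilbert-Schmidt inner product: the `(i, j)` entry
of `Φ†(Y)` is the inner product of `Φ(|i⟩⟨j|)` with `Y`. -/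
def adjointOp (Φ : SuperOp m n) : SuperOp n m where
  toFun Y := Matrix.of fun i j => ((Φ (Matrix.single i j 1)).conjTranspose * Y).trace
  map_add' Y Z := by
    ext i j
    simp [mul_add]
  map_smul' r Y := by
    ext i j
    simp

/-- `adjointOp` is characterised by `⟨B, Φ†(Y)⟩ = ⟨Φ(B), Y⟩`. -/
theorem trace_mul_adjointOp (Φ : SuperOp m n) (B : Matrix m m ℂ) (Y : Matrix n n ℂ) :
    (B.conjTranspose * adjointOp Φ Y).trace = ((Φ B).conjTranspose * Y).trace := by
  have hB : Φ B = ∑ i, ∑ j, B i j • Φ (Matrix.single i j 1) := by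
    conv_lhs => rw [Matrix.matrix_eq_sum_single B]
    simp only [map_sum]
    refine Finset.sum_congr rfl fun i _ => Finset.sum_congr rfl fun j _ => ?_
    rw [← map_smul, Matrix.smul_single, smul_eq_mul, mul_one]
  rw [hB]
  simp only [Matrix.conjTranspose_sum, Matrix.conjTranspose_smul, Matrix.sum_mul,
    Matrix.smul_mul, Matrix.trace_sum, Matrix.trace_smul]
  rw [Finset.sum_comm]
  simp [Matrix.trace, Matrix.mul_apply, adjointOp]

/-- The unnormalised maximally entangled vector `∑ᵢ |eᵢ⟩ ⊗ |eᵢ⟩`. -/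
def maxEntangled : m × m → ℂ := fun p => ∑ i, if p = (i, i) then 1 else 0

/-- `Λ(C, ρ) = ⟨ψ| (ρ ⊗ C) |ψ⟩`, with `ψ` the maximally entangled vector on the first two of
the three tensor factors, as a super-operator in `ρ`. -/
def choiAction (C : Matrix (m × n) (m × n) ℂ) : SuperOp m n where
  toFun ρ := Matrix.of fun k l => ∑ p : m × m, ∑ q : m × m,
    star (maxEntangled p) * (ρ ⊗ₖ C) (p.1, (p.2, k)) (q.1, (q.2, l)) * maxEntangled q
  map_add' ρ τ := by
    ext k l
    simp [mul_add, add_mul, Finset.sum_add_distrib]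
  map_smul' r ρ := by
    ext k l
    simp only [Matrix.smul_kronecker, Matrix.smul_apply, Matrix.of_apply, RingHom.id_apply,
      smul_eq_mul, Finset.mul_sum]
    exact Finset.sum_congr rfl fun p _ => Finset.sum_congr rfl fun q _ => by ring

theorem choiAction_apply (C : Matrix (m × n) (m × n) ℂ) (ρ : Matrix m m ℂ) (k l : n) :
    choiAction C ρ k l = ∑ i, ∑ j, ρ i j * C (i, k) (j, l) := by
  have h : ∀ i j : m, (maxEntangled (i, j) : ℂ) = if i = j then 1 else 0 := by
    intro i j
    by_cases hij : i = j
    · subst hij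
      simp [maxEntangled]
    · have : ∀ x : m, ¬ (i = x ∧ j = x) := fun x hx => hij (hx.1.trans hx.2.symm)
      simp [maxEntangled, hij, this]
  simp [choiAction, Fintype.sum_prod_type, h]

end Quantum

/-- A (finite-dimensional) discounted quantum Markov decision process: the transition channel
`N`, the Hermitian cost operator `c` and the discount factor `β`. The state system has
orthonormal basis indexed by `X`, the action system by `A`. -/
structure Model (X A : Type*) [Fintype X] [DecidableEq X] [Fintype A] [DecidableEq A] where
  N : SuperOp (X × A) X
  isChannel : IsQuantumChannel N
  c : Matrix (X × A) (X × A) ℂ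
  isHermitian : c.IsHermitian
  β : ℝ
  β_nonneg : 0 ≤ β
  β_lt_one : β < 1

variable {X A : Type*} [Fintype X] [DecidableEq X] [Fintype A] [DecidableEq A]

/-- The set `C_w`: channels `γ` with `Tr_A(γ(|x⟩⟨x|)) = |x⟩⟨x|` for every basis state. -/
def Cw (X A : Type*) [Fintype X] [DecidableEq X] [Fintype A] [DecidableEq A] :
    Set (SuperOp X (X × A)) :=
  {γ | IsQuantumChannel γ ∧ ∀ x : X, partialTrace (γ (ketbra x)) = ketbra x}

/-- The set `Γ_w` of classical-state-preserving closed-loop policies. -/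
def PoliciesW (X A : Type*) [Fintype X] [DecidableEq X] [Fintype A] [DecidableEq A] :
    Set (ℕ → SuperOp X (X × A)) :=
  {γ | ∀ t, γ t ∈ Cw X A}

/-- The stationary policy that uses `γ` at every time. -/
def stationary (γ : SuperOp X (X × A)) : ℕ → SuperOp X (X × A) := fun _ => γ

namespace Model

variable (M : Model X A)

/-- The state `ρ_t` at time `t`: `ρ_{t+1} = N(γ_t(ρ_t))`. -/
def state (γ : ℕ → SuperOp X (X × A)) (ρ₀ : Matrix X X ℂ) : ℕ → Matrix X X ℂ
  | 0 => ρ₀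
  | t + 1 => M.N (γ t (state γ ρ₀ t))

/-- The action `σ_t = γ_t(ρ_t)` at time `t`. -/
def action (γ : ℕ → SuperOp X (X × A)) (ρ₀ : Matrix X X ℂ) (t : ℕ) :
    Matrix (X × A) (X × A) ℂ :=
  γ t (M.state γ ρ₀ t)

/-- The discounted cost `V(γ, ρ₀) = ∑ₜ βᵗ ⟨c, σ_t⟩`. -/
noncomputable def value (γ : ℕ → SuperOp X (X × A)) (ρ₀ : Matrix X X ℂ) : ℝ :=
  ∑' t, M.β ^ t * hs M.c (M.action γ ρ₀ t)

/-- `γ` is an optimal classical-state-preserving closed-loop policy for the initial state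
`ρ₀`: it lies in `Γ_w` and attains the minimum of the cost over `Γ_w`. -/
def IsOptimalPolicy (ρ₀ : Matrix X X ℂ) (γ : ℕ → SuperOp X (X × A)) : Prop :=
  γ ∈ PoliciesW X A ∧ ∀ γ' ∈ PoliciesW X A, M.value γ ρ₀ ≤ M.value γ' ρ₀

/-- `T_w(σ) = N_qc(Tr_A(σ)) - β N_qc(N(σ))`. -/
noncomputable def Tw (σ : Matrix (X × A) (X × A) ℂ) : Matrix X X ℂ :=
  qcChannel (partialTrace σ) - (M.β : ℂ) • qcChannel (M.N σ)

/-- `T_w†(ξ) = N_qc(ξ) ⊗ Id - β N†(N_qc(ξ))`. -/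
noncomputable def TwAdj (ξ : Matrix X X ℂ) : Matrix (X × A) (X × A) ℂ :=
  qcChannel ξ ⊗ₖ (1 : Matrix A A ℂ) - (M.β : ℂ) • adjointOp M.N (qcChannel ξ)

/-- Feasibility in the dual semi-definite program: `c - T_w†(ξ) ≥ 0`. -/
def DualFeasible (ξ : Matrix X X ℂ) : Prop :=
  ξ.IsHermitian ∧ (M.c - M.TwAdj ξ).PosSemidef

/-- There is a dual feasible `ξ` such that, for every density operator `ρ`,
`min_{γ ∈ C_w} ⟨c + β N†(N_qc(ξ)), γ(ρ)⟩ = ⟨N_qc(ξ), ρ⟩`. -/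
def DualAssumption : Prop :=
  ∃ ξ : Matrix X X ℂ, M.DualFeasible ξ ∧ ∀ ρ : Matrix X X ℂ, IsDensity ρ →
    IsLeast
      ((fun γ : SuperOp X (X × A) =>
        hs (M.c + (M.β : ℂ) • adjointOp M.N (qcChannel ξ)) (γ ρ)) '' Cw X A)
      (hs (qcChannel ξ) ρ)

/-- The constraints of the bilinear program in the Hermitian variables `(σ, C)`. -/
structure BilFeasible (ρ₀ : Matrix X X ℂ) (σ : Matrix (X × A) (X × A) ℂ)
    (C : Matrix (X × (X × A)) (X × (X × A)) ℂ) : Prop where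
  sigma_hermitian : σ.IsHermitian
  choi_hermitian : C.IsHermitian
  occupation : M.Tw σ = ((1 - M.β : ℝ) : ℂ) • qcChannel ρ₀
  sigma_psd : σ.PosSemidef
  choi_trace : partialTrace C = (1 : Matrix X X ℂ)
  choi_psd : C.PosSemidef
  choi_preserves : ∀ x : X, partialTrace (choiAction C (ketbra x)) = ketbra x
  bilinear : choiAction C (((1 - M.β : ℝ) : ℂ) • ρ₀ + (M.β : ℂ) • M.N σ) = σ

/-- Optimal solutions of the bilinear program: minimise `⟨c, σ⟩` over feasible pairs. -/
def IsBilOptimal (ρ₀ : Matrix X X ℂ) (σ : Matrix (X × A) (X × A) ℂ)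
    (C : Matrix (X × (X × A)) (X × (X × A)) ℂ) : Prop :=
  M.BilFeasible ρ₀ σ C ∧
    ∀ σ' C', M.BilFeasible ρ₀ σ' C' → hs M.c σ ≤ hs M.c σ'

end Model

end QMDP

namespace QMDP
theorem IsQuantumChannel.isDensity {m n : Type*} [Fintype m] [DecidableEq m] [Fintype n] [DecidableEq n]
    {Φ : SuperOp m n} (h : IsQuantumChannel Φ) {ρ : Matrix m m ℂ}
    (hρ : IsDensity ρ) : IsDensity (Φ ρ) := by
  refine ⟨?_, (h.tracePreserving ρ).trans hρ.2⟩
  have h1 := h.completelyPositive 1 _ (hρ.1.submatrix (Prod.fst : m × Fin 1 → m))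
  exact h1.submatrix (fun i : n => (i, (0 : Fin 1)))

theorem IsDensity.norm_apply_le {m : Type*} [Fintype m] [DecidableEq m]
    {ρ : Matrix m m ℂ} (h : IsDensity ρ) (i j : m) : ‖ρ i j‖ ≤ 1 := by
  have hd : ∀ i, (ρ i i).im = 0 ∧ 0 ≤ (ρ i i).re := fun i => by
    have := h.1.diag_nonneg (i := i)
    rw [Complex.nonneg_iff] at this
    exact ⟨this.2.symm, this.1⟩
  have hs : ∑ i, (ρ i i).re = 1 := by
    have := congrArg Complex.re h.2
    simpa [Matrix.trace] using this
  have hle : ∀ i, (ρ i i).re ≤ 1 := fun i => by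
    rw [← hs]
    exact Finset.single_le_sum (f := fun i => (ρ i i).re) (fun i _ => (hd i).2) (Finset.mem_univ i)
  have hdet := (h.1.submatrix ![i, j]).det_nonneg
  rw [Matrix.det_fin_two] at hdet
  have hji : ρ j i = star (ρ i j) := (h.1.isHermitian.apply j i).symm
  simp only [Matrix.submatrix_apply, Matrix.cons_val_zero, Matrix.cons_val_one, hji] at hdet
  have := (Complex.nonneg_iff.1 hdet).1
  simp only [Complex.sub_re, Complex.mul_re, (hd i).1, (hd j).1, Complex.star_def,
    Complex.conj_re, Complex.conj_im] at this
  have hn : ‖ρ i j‖ ^ 2 = (ρ i j).re * (ρ i j).re + (ρ i j).im * (ρ i j).im := by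
    rw [Complex.sq_norm, Complex.normSq_apply]
  have := mul_le_one₀ (hle i) (hd j).2 (hle j)
  nlinarith [norm_nonneg (ρ i j)]

variable {X A : Type*} [Fintype X] [DecidableEq X] [Fintype A] [DecidableEq A]

/-- The states and actions under a policy in `Γ_w` are density operators. -/
theorem Model.isDensity_state (M : Model X A) {γ : ℕ → SuperOp X (X × A)}
    (hγ : γ ∈ PoliciesW X A) {ρ₀ : Matrix X X ℂ} (h : IsDensity ρ₀) (t : ℕ) :
    IsDensity (M.state γ ρ₀ t) := by
  induction t with
  | zero => exact h
  | succ t ih => exact M.isChannel.isDensity ((hγ t).1.isDensity ih)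

/-- The series defining the cost of a policy in `Γ_w` converges. -/
theorem Model.summable_value (M : Model X A) {γ : ℕ → SuperOp X (X × A)}
    (hγ : γ ∈ PoliciesW X A) {ρ₀ : Matrix X X ℂ} (h : IsDensity ρ₀) :
    Summable fun t => M.β ^ t * hs M.c (M.action γ ρ₀ t) := by
  refine Summable.of_norm_bounded
    ((summable_geometric_of_lt_one M.β_nonneg M.β_lt_one).mul_right (∑ i, ∑ j, ‖M.c i j‖)) ?_
  intro t
  have hσ : IsDensity (M.action γ ρ₀ t) := (hγ t).1.isDensity (M.isDensity_state hγ h t)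
  rw [norm_mul, Real.norm_of_nonneg (pow_nonneg M.β_nonneg t)]
  refine mul_le_mul_of_nonneg_left ?_ (pow_nonneg M.β_nonneg t)
  rw [Real.norm_eq_abs]
  refine (Complex.abs_re_le_norm _).trans ?_
  simp only [Matrix.trace, Matrix.diag, Matrix.mul_apply]
  refine (norm_sum_le _ _).trans (Finset.sum_le_sum fun i _ => (norm_sum_le _ _).trans
    (Finset.sum_le_sum fun j _ => ?_))
  rw [norm_mul]
  exact mul_le_of_le_one_right (norm_nonneg _) (hσ.norm_apply_le j i)

end QMDP

/-! For a stationary policy γ, the normalised occupation operator σ = (1-β) ∑ βᵗ σ_t satisfies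
γ((1-β)ρ₀ + β N(σ)) = σ (`exists_occupation`). Conversely, any density operator solving this
equation has ⟨c, σ⟩ = (1-β) V (`hs_eq_value`). Under the Choi correspondence the bilinear program
therefore minimises (1-β) V over stationary policies. The constraint on `Tw` costs nothing, since
channels in `Cw` preserve every diagonal.

Under the dual assumption put ζ = N_qc(ξ) and Q = c + β N†(ζ). By telescoping, V - ⟨ζ, ρ₀⟩ is the
discounted sum of the residuals ⟨Q, σ_t⟩ - ⟨ζ, ρ_t⟩, all nonnegative, so V ≥ ⟨ζ, ρ₀⟩ for every
policy. A channel with zero residual at the maximally mixed state has zero residual at every state: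
its residual is linear, nonnegative on the positive cone and zero at an interior point. Used at all
times it attains the bound, and the bilinear optimum costs no more than this stationary policy. -/

namespace Matrix

-- The operator norm serves as r. The identity is thus an order unit, which is how its interiority
-- in the positive cone is used.
open scoped Matrix.Norms.L2Operator MatrixOrder in
theorem PosSemidef.exists_smul_one_sub {n : Type*} [Fintype n] [DecidableEq n] {ρ : Matrix n n ℂ}
    (h : ρ.PosSemidef) : ∃ r : ℝ, (r • (1 : Matrix n n ℂ) - ρ).PosSemidef := by
  refine ⟨‖ρ‖, ?_⟩
  rw [← Algebra.algebraMap_eq_smul_one, ← le_iff]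
  exact IsSelfAdjoint.le_algebraMap_norm_self h.1.isSelfAdjoint

-- Summability is not needed: a divergent series has the default sum 0.
open scoped Matrix.Norms.L2Operator MatrixOrder in
theorem PosSemidef.tsum {n : Type*} [Fintype n] [DecidableEq n] {f : ℕ → Matrix n n ℂ}
    (h : ∀ t, (f t).PosSemidef) : (∑' t, f t).PosSemidef := by
  simp_rw [← nonneg_iff_posSemidef] at h ⊢
  exact tsum_nonneg h

/-- Summing the blocks of a positive semi-definite block matrix gives a positive semi-definite
matrix. -/
theorem PosSemidef.sum_blocks {m n : Type*} [Fintype m] [Fintype n]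
    {P : Matrix (m × n) (m × n) ℂ} (hP : P.PosSemidef) :
    (of fun p q : n => ∑ i, ∑ j, P (i, p) (j, q)).PosSemidef := by
  classical
  -- Compression by a column of identity blocks adds up all blocks of P.
  have h := hP.conjTranspose_mul_mul_same
    (of fun (ip : m × n) (q : n) => if ip.2 = q then (1 : ℂ) else 0)
  convert h using 1
  ext p q
  simp only [mul_apply, Fintype.sum_prod_type, conjTranspose_apply, of_apply, apply_ite star,
    star_one, star_zero, ite_mul, one_mul, zero_mul, mul_ite, mul_one, mul_zero,
    Finset.sum_ite_eq', Finset.mem_univ, if_true]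
  exact Finset.sum_comm

/-- The quadratic form vanishes at the i-th basis vector, which therefore lies in the kernel. -/
theorem PosSemidef.apply_eq_zero {n : Type*} [Fintype n] [DecidableEq n]
    {P : Matrix n n ℂ} (hP : P.PosSemidef) {i : n} (hi : P i i = 0) (j : n) : P i j = 0 := by
  have := (hP.dotProduct_mulVec_zero_iff (Pi.single i 1)).1 (by simpa using hi)
  have h2 := congrFun this j
  rw [← hP.1.apply]
  simpa using h2

end Matrix

namespace QMDP

/-! ### Choi matrices and quantum channels -/

section Choi

variable {m n : Type*} [DecidableEq m]

/-- The Choi matrix of a super-operator. -/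
def choi (Φ : SuperOp m n) : Matrix (m × n) (m × n) ℂ :=
  Matrix.of fun p q => Φ (Matrix.single p.1 q.1 1) p.2 q.2

variable [Fintype m] [Fintype n]

theorem choiAction_choi [DecidableEq n] (Φ : SuperOp m n) : choiAction (choi Φ) = Φ := by
  ext ρ k l
  rw [choiAction_apply]
  conv_rhs => rw [Matrix.matrix_eq_sum_single ρ]
  simp only [map_sum, Matrix.sum_apply]
  refine Finset.sum_congr rfl fun i _ => Finset.sum_congr rfl fun j _ => ?_
  have h : Matrix.single i j (ρ i j) = ρ i j • Matrix.single i j (1 : ℂ) := by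
    rw [Matrix.smul_single, smul_eq_mul, mul_one]
  rw [h, map_smul]
  rfl

/-- Complete positivity is the Schur product theorem: the ampliated output is the block sum of a
Hadamard product of copies of P and C. -/
theorem isQuantumChannel_choiAction [DecidableEq n] {C : Matrix (m × n) (m × n) ℂ}
    (hC : C.PosSemidef) (htr : partialTrace C = 1) : IsQuantumChannel (choiAction C) where
  completelyPositive k P hP := by
    have h := ((hP.submatrix fun x : m × (n × Fin k) => (x.1, x.2.2)).hadamard
      (hC.submatrix fun x : m × (n × Fin k) => (x.1, x.2.1))).sum_blocks
    convert h using 1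
    ext p q
    simp [ampliate, choiAction_apply]
  tracePreserving ρ := by
    have h (i j : m) : ∑ k, C (i, k) (j, k) = (1 : Matrix m m ℂ) i j := by
      rw [← htr]; rfl
    simp only [Matrix.trace, Matrix.diag, choiAction_apply]
    rw [Finset.sum_comm]
    refine Finset.sum_congr rfl fun i _ => ?_
    rw [Finset.sum_comm]
    simp [← Finset.mul_sum, h, Matrix.one_apply]

variable {Φ : SuperOp m n}

theorem IsQuantumChannel.posSemidef_choi (h : IsQuantumChannel Φ) : (choi Φ).PosSemidef := by
  -- The Choi matrix is the ampliation applied to the maximally entangled projector; e moves the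
  -- second copy of m into the `Fin` environment.
  let e := Fintype.equivFin m
  let v : m × Fin (Fintype.card m) → ℂ := fun p => if e p.1 = p.2 then 1 else 0
  have hΦ := (h.completelyPositive _ _ (Matrix.posSemidef_vecMulVec_self_star v)).submatrix
    fun p : m × n => (p.2, e p.1)
  convert hΦ using 1
  ext p q
  simp only [choi, ampliate, Matrix.of_apply, Matrix.submatrix_apply]
  congr! 1
  ext i j
  simp [v, Matrix.vecMulVec_apply, Matrix.single_apply, eq_comm, ← ite_and, and_comm]

theorem IsQuantumChannel.partialTrace_choi (h : IsQuantumChannel Φ) :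
    partialTrace (choi Φ) = 1 := by
  ext i j
  have := h.tracePreserving (Matrix.single i j 1)
  by_cases hij : i = j
  · subst hij
    simpa [Matrix.trace, partialTrace, choi] using this
  · simpa [Matrix.trace, hij, Matrix.single_apply, partialTrace, choi] using this

theorem qcChannel_eq_diagonal (ρ : Matrix m m ℂ) :
    qcChannel ρ = Matrix.diagonal fun x => ρ x x := by
  ext i j
  simp [qcChannel, ketbra, Matrix.sum_apply, Matrix.single_apply, Matrix.diagonal_apply, ite_and,
    Matrix.trace_mul_single]

end Choi

/-! ### Hilbert-Schmidt pairing and discounted sums -/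

section HilbertSchmidt

variable {m : Type*} [Fintype m]

theorem hs_add_right (P Q R : Matrix m m ℂ) : hs P (Q + R) = hs P Q + hs P R := by
  simp [hs, mul_add]

theorem hs_add_left (P Q R : Matrix m m ℂ) : hs (P + Q) R = hs P R + hs Q R := by
  simp [hs, add_mul]

theorem hs_smul_right (r : ℝ) (P Q : Matrix m m ℂ) : hs P ((r : ℂ) • Q) = r * hs P Q := by
  simp [hs]

theorem hs_smul_left (r : ℝ) (P Q : Matrix m m ℂ) : hs ((r : ℂ) • P) Q = r * hs P Q := by
  simp [hs]

theorem hs_adjointOp {n : Type*} [DecidableEq m] [Fintype n] [DecidableEq n] {Φ : SuperOp m n}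
    {ρ : Matrix m m ℂ} (hρ : ρ.IsHermitian) (hΦ : (Φ ρ).IsHermitian) (Y : Matrix n n ℂ) :
    hs (adjointOp Φ Y) ρ = hs Y (Φ ρ) := by
  have h := trace_mul_adjointOp Φ ρ Y
  rw [hρ.eq, hΦ.eq] at h
  rw [hs, hs, Matrix.trace_mul_comm, h, Matrix.trace_mul_comm]

theorem exists_abs_hs_le [DecidableEq m] (P : Matrix m m ℂ) :
    ∃ K, ∀ ρ, IsDensity ρ → |hs P ρ| ≤ K := by
  refine ⟨∑ i, ∑ j, ‖P i j‖, fun ρ hρ => (Complex.abs_re_le_norm _).trans ?_⟩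
  simp only [Matrix.trace, Matrix.diag, Matrix.mul_apply]
  refine (norm_sum_le _ _).trans (Finset.sum_le_sum fun i _ => (norm_sum_le _ _).trans
    (Finset.sum_le_sum fun j _ => ?_))
  rw [norm_mul]
  exact mul_le_of_le_one_right (norm_nonneg _) (hρ.norm_apply_le j i)

end HilbertSchmidt

theorem hasSum_of_forall_eq {α : Type*} [AddCommMonoid α] [TopologicalSpace α] {f g : ℕ → α}
    {a : α} (h : HasSum f a) (hfg : ∀ t, g t = f t) : HasSum g a :=
  funext hfg ▸ h

/-- Discounted telescoping of a bounded sequence. -/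
theorem hasSum_pow_mul_sub {β K : ℝ} (h0 : 0 ≤ β) (h1 : β < 1) {a : ℕ → ℝ}
    (ha : ∀ t, |a t| ≤ K) : HasSum (fun t => β ^ t * (a t - β * a (t + 1))) (a 0) := by
  have hs : Summable fun t => β ^ t * a t := by
    refine Summable.of_norm_bounded ((summable_geometric_of_lt_one h0 h1).mul_right K) fun t => ?_
    rw [norm_mul, Real.norm_of_nonneg (pow_nonneg h0 t)]
    exact mul_le_mul_of_nonneg_left (ha t) (pow_nonneg h0 t)
  have h := hs.hasSum.sub ((hasSum_nat_add_iff' 1).2 hs.hasSum)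
  have hf : (fun t => β ^ t * (a t - β * a (t + 1))) =
      fun t => β ^ t * a t - β ^ (t + 1) * a (t + 1) := by
    funext t
    ring
  rw [hf]
  simpa using h

variable {X A : Type*} [Fintype X] [DecidableEq X] [Fintype A] [DecidableEq A]

/-- Channels in `C_w` preserve the diagonal of every operator, not only of basis states. -/
theorem qcChannel_partialTrace_of_mem_Cw {γ : SuperOp X (X × A)} (hγ : γ ∈ Cw X A)
    (ρ : Matrix X X ℂ) : qcChannel (partialTrace (γ ρ)) = qcChannel ρ := by
  have hC := hγ.1.posSemidef_choi
  have hsum (x z : X) : ∑ a, choi γ (x, (z, a)) (x, (z, a)) = if x = z then 1 else 0 := by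
    have := congrFun₂ (hγ.2 x) z z
    simpa [partialTrace, ketbra, choi, Matrix.single_apply] using this
  -- Nonnegative diagonal entries summing to zero all vanish, and positivity then kills their whole
  -- rows and columns.
  have hzero {x z : X} (hxz : x ≠ z) (a : A) (q) : choi γ (x, (z, a)) q = 0 := by
    refine hC.apply_eq_zero ?_ q
    have h := hsum x z
    rw [if_neg hxz, Finset.sum_eq_zero_iff_of_nonneg fun a _ => hC.diag_nonneg] at h
    exact h a (Finset.mem_univ a)
  have hzero' {x z : X} (hxz : x ≠ z) (a : A) (q) : choi γ q (x, (z, a)) = 0 := by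
    rw [← hC.1.apply, hzero hxz, star_zero]
  rw [qcChannel_eq_diagonal, qcChannel_eq_diagonal]
  congr 1
  ext z
  change ∑ a, γ ρ (z, a) (z, a) = ρ z z
  conv_lhs => rw [← choiAction_choi γ]
  simp only [choiAction_apply]
  rw [Finset.sum_comm, Finset.sum_eq_single z, Finset.sum_comm, Finset.sum_eq_single z]
  · rw [← Finset.mul_sum, hsum, if_pos rfl, mul_one]
  · intro j _ hj
    simp [hzero' hj]
  · simp
  · intro i _ hi
    simp [hzero hi]
  · simp

theorem isDensity_smul_tsum {n : Type*} [Fintype n] [DecidableEq n] {f : ℕ → Matrix n n ℂ}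
    (hf : ∀ t, IsDensity (f t)) {β : ℝ} (h0 : 0 ≤ β) (h1 : β < 1) :
    Summable (fun t => (β : ℂ) ^ t • f t) ∧
    IsDensity (((1 - β : ℝ) : ℂ) • ∑' t, (β : ℂ) ^ t • f t) := by
  have hs : Summable (fun t => (β : ℂ) ^ t • f t) := by
    refine Pi.summable.2 fun i => Pi.summable.2 fun j => ?_
    refine Summable.of_norm_bounded (summable_geometric_of_lt_one h0 h1) fun t => ?_
    simp only [Matrix.smul_apply, smul_eq_mul, norm_mul, norm_pow, Complex.norm_real,
      Real.norm_of_nonneg h0]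
    exact mul_le_of_le_one_right (pow_nonneg h0 t) ((hf t).norm_apply_le i j)
  refine ⟨hs, ?_, ?_⟩
  · refine Matrix.PosSemidef.smul (Matrix.PosSemidef.tsum fun t => (hf t).1.smul ?_) ?_
    · exact pow_nonneg (by exact_mod_cast h0) t
    · exact_mod_cast (sub_nonneg.2 h1.le)
  · have htr := hs.hasSum.mapL (Matrix.traceLinearMap n ℂ ℂ).toContinuousLinearMap
    have hg : HasSum (fun t : ℕ => (β : ℂ) ^ t) (1 - (β : ℂ))⁻¹ :=
      hasSum_geometric_of_norm_lt_one (by rwa [Complex.norm_real, Real.norm_of_nonneg h0])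
    have hne : (1 - (β : ℂ)) ≠ 0 := by exact_mod_cast (sub_pos.2 h1).ne'
    have := htr.unique (by simpa [(hf _).2] using hg)
    rw [Matrix.trace_smul, show (∑' t, (β : ℂ) ^ t • f t).trace = _ from this]
    simp [hne]

/-! ### The bilinear program and the Bellman residual -/

namespace Model

variable (M : Model X A)

/-- The occupation constraint follows from the fixed-point equation by taking diagonals, which γ
preserves. -/
theorem bilFeasible_choi {γ : SuperOp X (X × A)} (hγ : γ ∈ Cw X A) {ρ₀ : Matrix X X ℂ}
    {σ : Matrix (X × A) (X × A) ℂ} (hσ : IsDensity σ)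
    (hfix : γ (((1 - M.β : ℝ) : ℂ) • ρ₀ + (M.β : ℂ) • M.N σ) = σ) :
    M.BilFeasible ρ₀ σ (choi γ) where
  sigma_hermitian := hσ.1.1
  choi_hermitian := hγ.1.posSemidef_choi.1
  occupation := by
    have h : qcChannel (partialTrace σ) =
        qcChannel (((1 - M.β : ℝ) : ℂ) • ρ₀ + (M.β : ℂ) • M.N σ) := by
      rw [← qcChannel_partialTrace_of_mem_Cw hγ (_ + _), hfix]
    rw [Tw, h]
    simp only [map_add, map_smul]
    abel
  sigma_psd := hσ.1
  choi_trace := hγ.1.partialTrace_choi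
  choi_psd := hγ.1.posSemidef_choi
  choi_preserves := by rw [choiAction_choi]; exact hγ.2
  bilinear := by rw [choiAction_choi]; exact hfix

variable {M}

theorem BilFeasible.choiAction_mem_Cw {ρ₀ : Matrix X X ℂ} {σ : Matrix (X × A) (X × A) ℂ}
    {C : Matrix (X × (X × A)) (X × (X × A)) ℂ} (h : M.BilFeasible ρ₀ σ C) :
    choiAction C ∈ Cw X A :=
  ⟨isQuantumChannel_choiAction h.choi_psd h.choi_trace, h.choi_preserves⟩

/-- Taking traces in the bilinear constraint gives t = (1-β) + βt, so t = 1. -/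
theorem BilFeasible.isDensity {ρ₀ : Matrix X X ℂ} (hρ₀ : IsDensity ρ₀)
    {σ : Matrix (X × A) (X × A) ℂ}
    {C : Matrix (X × (X × A)) (X × (X × A)) ℂ} (h : M.BilFeasible ρ₀ σ C) : IsDensity σ := by
  refine ⟨h.sigma_psd, ?_⟩
  have ht := congrArg Matrix.trace h.bilinear
  rw [h.choiAction_mem_Cw.1.tracePreserving, Matrix.trace_add, Matrix.trace_smul,
    Matrix.trace_smul, M.isChannel.tracePreserving, hρ₀.2] at ht
  have hne : (1 - (M.β : ℂ)) ≠ 0 := by exact_mod_cast (sub_pos.2 M.β_lt_one).ne'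
  refine mul_left_cancel₀ hne ?_
  simp only [smul_eq_mul, Complex.ofReal_sub, Complex.ofReal_one] at ht
  linear_combination -ht

variable (M)

/-- For every channel in `C_w` the normalised discounted occupation operator is a density operator
solving the bilinear fixed-point equation. -/
theorem exists_occupation {γ : SuperOp X (X × A)} (hγ : γ ∈ Cw X A) {ρ₀ : Matrix X X ℂ}
    (hρ₀ : IsDensity ρ₀) : ∃ σ, IsDensity σ ∧
      γ (((1 - M.β : ℝ) : ℂ) • ρ₀ + (M.β : ℂ) • M.N σ) = σ := by
  obtain ⟨hs, hd⟩ := isDensity_smul_tsum (f := M.action (stationary γ) ρ₀)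
    (fun t => hγ.1.isDensity (M.isDensity_state (fun _ => hγ) hρ₀ t)) M.β_nonneg M.β_lt_one
  refine ⟨_, hd, ?_⟩
  -- Applying β γ∘N termwise shifts the occupation series by one index; the missing term at time 0
  -- is γ(ρ₀).
  have hmap := hs.hasSum.mapL (γ ∘ₗ M.N).toContinuousLinearMap
  have hshift : HasSum (fun t => (M.β : ℂ) ^ (t + 1) • M.action (stationary γ) ρ₀ (t + 1))
      ((M.β : ℂ) • γ (M.N (∑' t, (M.β : ℂ) ^ t • M.action (stationary γ) ρ₀ t))) := by
    refine hasSum_of_forall_eq (hmap.const_smul (M.β : ℂ)) fun t => ?_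
    rw [map_smul, smul_smul, ← pow_succ']
    rfl
  have htot := hs.tsum_eq_zero_add
  rw [hshift.tsum_eq, pow_zero, one_smul] at htot
  conv_rhs => rw [htot]
  simp only [map_add, map_smul, smul_add]
  rw [smul_comm (M.β : ℂ)]
  rfl

/-- A fixed point of the bilinear equation carries the normalised cost of the stationary policy. -/
theorem hs_eq_value {γ : SuperOp X (X × A)} (hγ : γ ∈ Cw X A) {ρ₀ : Matrix X X ℂ}
    (hρ₀ : IsDensity ρ₀) {σ : Matrix (X × A) (X × A) ℂ} (hσ : IsDensity σ)
    (hfix : γ (((1 - M.β : ℝ) : ℂ) • ρ₀ + (M.β : ℂ) • M.N σ) = σ) :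
    hs M.c σ = (1 - M.β) * M.value (stationary γ) ρ₀ := by
  have hd (t : ℕ) : IsDensity ((fun τ => γ (M.N τ))^[t] σ) := by
    induction t with
    | zero => exact hσ
    | succ t ih =>
      rw [Function.iterate_succ_apply']
      exact hγ.1.isDensity (M.isChannel.isDensity ih)
  -- Iterating the fixed-point equation under γ∘N yields a telescoping recursion, so uniqueness of
  -- the fixed point is not needed.
  have hrec (t : ℕ) : (fun τ => γ (M.N τ))^[t] σ =
      ((1 - M.β : ℝ) : ℂ) • M.action (stationary γ) ρ₀ t +
        (M.β : ℂ) • (fun τ => γ (M.N τ))^[t + 1] σ := by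
    induction t with
    | zero =>
      rw [map_add, map_smul, map_smul] at hfix
      exact hfix.symm
    | succ t ih =>
      rw [Function.iterate_succ_apply', ih, map_add, map_add, map_smul, map_smul, map_smul,
        map_smul, Function.iterate_succ_apply' _ (t + 1)]
      rfl
  obtain ⟨K, hK⟩ := exists_abs_hs_le M.c
  have hsum := hasSum_pow_mul_sub M.β_nonneg M.β_lt_one fun t => hK _ (hd t)
  refine hsum.unique ?_
  refine hasSum_of_forall_eq
    ((M.summable_value (γ := stationary γ) (fun _ => hγ) hρ₀).hasSum.mul_left (1 - M.β)) fun t => ?_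
  have := congrArg (hs M.c) (hrec t)
  rw [hs_add_right, hs_smul_right, hs_smul_right] at this
  rw [this]
  ring

theorem value_choiAction_le {ρ₀ : Matrix X X ℂ} (hρ₀ : IsDensity ρ₀)
    {σ : Matrix (X × A) (X × A) ℂ} {C : Matrix (X × (X × A)) (X × (X × A)) ℂ}
    (hopt : M.IsBilOptimal ρ₀ σ C) {γ : SuperOp X (X × A)} (hγ : γ ∈ Cw X A) :
    M.value (stationary (choiAction C)) ρ₀ ≤ M.value (stationary γ) ρ₀ := by
  obtain ⟨τ, hτ, hfix⟩ := M.exists_occupation hγ hρ₀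
  have h := hopt.2 _ _ (M.bilFeasible_choi hγ hτ hfix)
  rw [M.hs_eq_value hopt.1.choiAction_mem_Cw hρ₀ (hopt.1.isDensity hρ₀) hopt.1.bilinear,
    M.hs_eq_value hγ hρ₀ hτ hfix] at h
  exact le_of_mul_le_mul_left h (sub_pos.2 M.β_lt_one)

/-- The discounted cost differs from `⟨ζ, ρ₀⟩` by the accumulated Bellman residuals
`⟨c + β N†(ζ), σ_t⟩ - ⟨ζ, ρ_t⟩`. -/
theorem hasSum_bellman_residual {γ : ℕ → SuperOp X (X × A)} (hγ : γ ∈ PoliciesW X A)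
    {ρ₀ : Matrix X X ℂ} (hρ₀ : IsDensity ρ₀) (ζ : Matrix X X ℂ) :
    HasSum (fun t => M.β ^ t * (hs (M.c + (M.β : ℂ) • adjointOp M.N ζ) (M.action γ ρ₀ t) -
      hs ζ (M.state γ ρ₀ t))) (M.value γ ρ₀ - hs ζ ρ₀) := by
  obtain ⟨K, hK⟩ := exists_abs_hs_le ζ
  have hd := M.isDensity_state hγ hρ₀
  refine hasSum_of_forall_eq ((M.summable_value hγ hρ₀).hasSum.sub
    (hasSum_pow_mul_sub M.β_nonneg M.β_lt_one fun t => hK _ (hd t))) fun t => ?_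
  rw [hs_add_left, hs_smul_left, hs_adjointOp (ρ := M.action γ ρ₀ t)
    ((hγ t).1.isDensity (hd t)).1.1 (hd (t + 1)).1.1]
  change _ = _ - _ * (_ - _ * hs ζ (M.N (M.action γ ρ₀ t)))
  ring

/-- Under the dual assumption some stationary policy attains the minimum of the cost over all
policies. -/
theorem DualAssumption.exists_stationary (h : M.DualAssumption) {ρ₀ : Matrix X X ℂ}
    (hρ₀ : IsDensity ρ₀) :
    ∃ γ ∈ Cw X A, ∀ γ' ∈ PoliciesW X A, M.value (stationary γ) ρ₀ ≤ M.value γ' ρ₀ := by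
  obtain ⟨ξ, -, hξ⟩ := h
  set ζ := qcChannel ξ
  set Q := M.c + (M.β : ℂ) • adjointOp M.N ζ
  -- The assumption concerns density operators; homogeneity extends it to the whole cone, as
  -- required for r • 1 - τ below.
  have hlow {γ : SuperOp X (X × A)} (hγ : γ ∈ Cw X A) {τ : Matrix X X ℂ} (hτ : τ.PosSemidef) :
      hs ζ τ ≤ hs Q (γ τ) := by
    obtain ⟨hre, him⟩ := Complex.nonneg_iff.1 hτ.trace_nonneg
    have htr : τ.trace = (τ.trace.re : ℂ) := Complex.ext rfl him.symm
    rcases hre.eq_or_lt with h0 | hpos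
    · rw [← h0, Complex.ofReal_zero, hτ.trace_eq_zero_iff] at htr
      simp [htr, hs]
    · have hd : IsDensity (((τ.trace.re⁻¹ : ℝ) : ℂ) • τ) := by
        refine ⟨hτ.smul (by exact_mod_cast (inv_pos.2 hpos).le), ?_⟩
        rw [Matrix.trace_smul, htr, Complex.ofReal_re, smul_eq_mul, ← Complex.ofReal_mul,
          inv_mul_cancel₀ hpos.ne', Complex.ofReal_one]
      have := (hξ _ hd).2 ⟨γ, hγ, rfl⟩
      simp only [map_smul, hs_smul_right] at this
      exact le_of_mul_le_mul_left this (inv_pos.2 hpos)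
  have hne : Nonempty X := by
    by_contra hX
    rw [not_nonempty_iff] at hX
    simpa [Matrix.trace] using hρ₀.2
  have hcard : (0 : ℝ) < (Fintype.card X : ℝ)⁻¹ := by positivity
  have hmix : IsDensity ((((Fintype.card X : ℝ)⁻¹ : ℝ) : ℂ) • (1 : Matrix X X ℂ)) := by
    refine ⟨Matrix.PosSemidef.one.smul (by exact_mod_cast hcard.le), ?_⟩
    simp
  obtain ⟨γ, hγ, heq⟩ := (hξ _ hmix).1
  simp only [map_smul, hs_smul_right] at heq
  have hone : hs Q (γ 1) = hs ζ 1 := mul_left_cancel₀ hcard.ne' heq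
  -- The residual is nonnegative at both τ and r • 1 - τ, and zero at their sum, so it vanishes at
  -- τ. One minimiser thus works for every state.
  have hall {τ : Matrix X X ℂ} (hτ : τ.PosSemidef) : hs Q (γ τ) = hs ζ τ := by
    obtain ⟨r, hr⟩ := hτ.exists_smul_one_sub
    have h1 := hlow hγ hr
    rw [← Complex.coe_smul, map_sub, map_smul, sub_eq_add_neg, sub_eq_add_neg,
      ← neg_one_smul ℂ τ, ← neg_one_smul ℂ (γ τ), ← Complex.ofReal_one, ← Complex.ofReal_neg] at h1
    simp only [hs_add_right, hs_smul_right, hone] at h1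
    exact le_antisymm (by linarith) (hlow hγ hτ)
  refine ⟨γ, hγ, fun γ' hγ' => ?_⟩
  have hstat : stationary γ ∈ PoliciesW X A := fun _ => hγ
  have h0 : M.value (stationary γ) ρ₀ - hs ζ ρ₀ = 0 := by
    refine (M.hasSum_bellman_residual hstat hρ₀ ζ).unique ?_
    refine hasSum_of_forall_eq hasSum_zero fun t => ?_
    exact mul_eq_zero_of_right _ (sub_eq_zero.2 (hall (M.isDensity_state hstat hρ₀ t).1))
  have h1 : 0 ≤ M.value γ' ρ₀ - hs ζ ρ₀ :=
    (M.hasSum_bellman_residual hγ' hρ₀ ζ).nonneg fun t =>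
      mul_nonneg (pow_nonneg M.β_nonneg t)
        (sub_nonneg.2 (hlow (hγ' t) (M.isDensity_state hγ' hρ₀ t).1))
  linarith

end Model

end QMDP

theorem mainTheorem10 {X A : Type*} [Fintype X] [DecidableEq X] [Fintype A] [DecidableEq A]
    (M : QMDP.Model X A) (ρ₀ : Matrix X X ℂ) (hρ₀ : QMDP.IsDensity ρ₀)
    (σ : Matrix (X × A) (X × A) ℂ) (C : Matrix (X × (X × A)) (X × (X × A)) ℂ)
    (hopt : M.IsBilOptimal ρ₀ σ C) :
    QMDP.choiAction C ∈ QMDP.Cw X A ∧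
    (∀ γ ∈ QMDP.Cw X A,
      M.value (QMDP.stationary (QMDP.choiAction C)) ρ₀ ≤ M.value (QMDP.stationary γ) ρ₀) ∧
    (M.DualAssumption → M.IsOptimalPolicy ρ₀ (QMDP.stationary (QMDP.choiAction C))) := by
  have hmem := hopt.1.choiAction_mem_Cw
  refine ⟨hmem, fun γ hγ => M.value_choiAction_le hρ₀ hopt hγ, fun hdual => ⟨fun _ => hmem, ?_⟩⟩
  obtain ⟨γ, hγ, hle⟩ := hdual.exists_stationary M hρ₀
  exact fun γ' hγ' => (M.value_choiAction_le hρ₀ hopt hγ).trans (hle γ' hγ')
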